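/- Let $\mathbb F$ be a field of characteristic zero, and let $G=\langle\sigma,\tau\rangle$ be a finite group such that $\tau^{-1}\sigma\tau=\sigma^{r}$ for some $r\in\mathbb Z$ and the orders $n$ of $\sigma$ and $m$ of $\tau$ are coprime; thus $G=C_n\rtimes C_m$ with $C_n=\langle\sigma\rangle$, $C_m=\langle\tau\rangle$ (every finite group all of whose Sylow subgroups are cyclic, i.e. every Z-group, has this form). For a $G$-lattice $M$ (a $G$-module that is free of finite rank over $\mathbb Z$) let $\mathbb F(M)$ be the fraction field of the group algebra $\mathbb F[M]$, with the $\mathbb F$-linear $G$-action induced by $g(x^{a})=x^{g(a)}$ for $a\in M$, and let $\mathbb F(M)^G$ be its fixed field. A finite $G$-graph $X=(V,E)$ is a finite directed graph, loops and multiple edges allowed, with actions of $G$ on the vertex set $V$ and the edge set $E$ that commute with the source and target maps; it is connected if its underlying undirected graph is. Its flow lattice is $$Fl(X)=\Big\{f:E\to\mathbb Z \;:\; \sum_{e\text{ with source }v}f(e)=\sum_{e\text{ with target }v}f(e)\ \text{ for all }v\in V\Big\},\qquad (gf)(e)=f(g^{-1}e).$$ Theorem. Let $X_1$ be any connected finite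 $G$-graph with vertex set $G$ (with $G$ acting by left multiplication), and let $X_2$ be any connected finite $G$-graph with vertex set $G/\langle\tau\rangle$ (with $G$ acting on left cosets by left multiplication). Then the fields $\mathbb F(\mathbb ZG\oplus Fl(X_1))^G$ and $\mathbb F(\mathbb ZG\oplus Fl(X_2))^G$ are stably isomorphic over $\mathbb F$: there are $s,t\ge 0$ and independent indeterminates $x_1,\dots,x_s$ and $y_1,\dots,y_t$ such that $$\mathbb F(\mathbb ZG\oplus Fl(X_1))^G(x_1,\dots,x_s)\;\cong\;\mathbb F(\mathbb ZG\oplus Fl(X_2))^G(y_1,\dots,y_t)$$ as $\mathbb F$-algebras. -/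

import Mathlib

/-! ### Fields attached to `G`-lattices -/

section Lattice

variable (F : Type*) [Field F] {G : Type*} [Group G]
  {M : Type*} [AddCommGroup M] [Module ℤ M]

/-- The group algebra `F[M]` of a free abelian group `M` over a field `F` is a domain. -/
instance groupAlgebra_isDomain [Module.Free ℤ M] : IsDomain (AddMonoidAlgebra F M) := by
  have : TwoUniqueSums M :=
    TwoUniqueSums.of_injective_addHom
      (Module.Free.chooseBasis ℤ M).repr.toLinearMap.toAddMonoidHom.toAddHom
      (Module.Free.chooseBasis ℤ M).repr.injective inferInstance
  have : NoZeroDivisors (AddMonoidAlgebra F M) := inferInstance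
  exact NoZeroDivisors.to_isDomain _

/-- The field `F(M)`, the fraction field of the group algebra `F[M]`. -/
abbrev LatticeField (M : Type*) [AddCommGroup M] : Type _ :=
  FractionRing (AddMonoidAlgebra F M)

/-- The additive automorphism `m ↦ g m` of a `G`-module. -/
def latticeAddEquiv (ρ : Representation ℤ G M) (g : G) : M ≃+ M where
  toFun := ρ g
  invFun := ρ g⁻¹
  left_inv m := by
    rw [← Module.End.mul_apply, ← map_mul, inv_mul_cancel, map_one, Module.End.one_apply]
  right_inv m := by
    rw [← Module.End.mul_apply, ← map_mul, mul_inv_cancel, map_one, Module.End.one_apply]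
  map_add' := map_add (ρ g)

/-- The action of `G` on `F[M]` by `F`-algebra automorphisms, `g (α x^m) = α x^(g m)`. -/
noncomputable def groupAlgebraAction (ρ : Representation ℤ G M) :
    G →* (AddMonoidAlgebra F M ≃ₐ[F] AddMonoidAlgebra F M) where
  toFun g := AddMonoidAlgebra.domCongr F F (latticeAddEquiv ρ g)
  map_one' := by
    ext a
    simp [latticeAddEquiv]
  map_mul' g h := by
    ext a
    simp [latticeAddEquiv]

/-- The induced action of `G` on the field `F(M)`; it is trivial on `F`. -/
noncomputable def latticeFieldAction [Module.Free ℤ M] (ρ : Representation ℤ G M) :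
    G →* (LatticeField F M ≃ₐ[F] LatticeField F M) :=
  (IsFractionRing.fieldEquivOfAlgEquivHom F (LatticeField F M)).comp (groupAlgebraAction F ρ)

/-- The invariant field `F(M)^G`, as an intermediate field of `F(M) / F`. -/
noncomputable def invariantField [Module.Free ℤ M] (ρ : Representation ℤ G M) :
    IntermediateField F (LatticeField F M) :=
  IntermediateField.fixedField (latticeFieldAction F ρ).range

end Lattice

/-- Two field extensions `L₁`, `L₂` of `F` are stably isomorphic over `F` if some purely
transcendental extensions `L₁(x₁, …, x_m)` and `L₂(y₁, …, y_k)` of finite transcendence degree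
are isomorphic as `F`-algebras. -/
def StablyIsomorphic (F L₁ L₂ : Type*) [Field F] [Field L₁] [Field L₂]
    [Algebra F L₁] [Algebra F L₂] : Prop :=
  ∃ m k : ℕ, Nonempty
    (FractionRing (MvPolynomial (Fin m) L₁) ≃ₐ[F] FractionRing (MvPolynomial (Fin k) L₂))

/-! ### Graphs with a group action and their flows -/

/-- A directed graph (loops and parallel edges allowed) with vertex set `V` and edge set `E`,
on which `G` acts compatibly with sources and targets. -/
structure GGraph (G V E : Type*) [Group G] [MulAction G V] [MulAction G E] where
  source : E → V
  target : E → V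
  source_smul : ∀ (g : G) (e : E), source (g • e) = g • source e
  target_smul : ∀ (g : G) (e : E), target (g • e) = g • target e

namespace GGraph

variable {G V E : Type*} [Group G] [MulAction G V] [MulAction G E]

/-- The underlying undirected graph is (nonempty and) connected. Loops and multiplicities of edges
do not matter for this, so they are forgotten. -/
def Connected (X : GGraph G V E) : Prop :=
  (SimpleGraph.fromRel fun u v : V => ∃ e : E, X.source e = u ∧ X.target e = v).Connected

variable [Fintype E]

open Classical in
/-- The flow lattice `Fl(X)`: functions `f : E → ℤ` such that at each vertex the total
outgoing value equals the total incoming value. -/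
noncomputable def flow (X : GGraph G V E) : Submodule ℤ (E → ℤ) where
  carrier := {f | ∀ v : V, ∑ e with X.source e = v, f e = ∑ e with X.target e = v, f e}
  zero_mem' v := by simp
  add_mem' {f g} hf hg v := by
    simp only [Pi.add_apply, Finset.sum_add_distrib, hf v, hg v]
  smul_mem' c f hf v := by
    simp only [Pi.smul_apply, ← Finset.smul_sum, hf v]

theorem comp_smul_mem_flow (X : GGraph G V E) (g : G) {f : E → ℤ} (hf : f ∈ X.flow) :
    (fun e => f (g⁻¹ • e)) ∈ X.flow := by
  classical
  have key : ∀ s : E → V, (∀ e, s (g • e) = g • s e) → ∀ v : V,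
      ∑ e with s e = v, f (g⁻¹ • e) = ∑ e with s e = g⁻¹ • v, f e := by
    intro s hs v
    refine Finset.sum_bij' (fun e _ => g⁻¹ • e) (fun e _ => g • e) ?_ ?_ ?_ ?_ ?_
    · intro e he
      simp only [Finset.mem_filter, Finset.mem_univ, true_and] at he ⊢
      rw [eq_inv_smul_iff, ← hs, smul_inv_smul, he]
    · intro e he
      simp only [Finset.mem_filter, Finset.mem_univ, true_and] at he ⊢
      rw [hs, he, smul_inv_smul]
    · intro e _
      simp
    · intro e _
      simp
    · intro e _
      rfl
  intro v
  have h := hf (g⁻¹ • v)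
  have h₁ := key X.source (X.source_smul g) v
  have h₂ := key X.target (X.target_smul g) v
  convert (h₁.trans (Eq.trans ?_ h₂.symm))
  convert h

/-- The action of `G` on the flow lattice, `(g f)(e) = f(g⁻¹ e)`. -/
noncomputable def flowRep (X : GGraph G V E) : Representation ℤ G X.flow where
  toFun g :=
    { toFun := fun f => ⟨fun e => f.1 (g⁻¹ • e), X.comp_smul_mem_flow g f.2⟩
      map_add' := fun _ _ => rfl
      map_smul' := fun _ _ => rfl }
  map_one' := by
    ext f e
    simp
  map_mul' g h := by
    ext f e
    simp [mul_smul]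

/-- The invariant field `F(ℤG ⊕ Fl(X))^G`, where `ℤG` is the left regular lattice. -/
noncomputable abbrev flowInvariantField (F : Type*) [Field F] (X : GGraph G V E) :
    IntermediateField F (LatticeField F (MonoidAlgebra ℤ G × X.flow)) :=
  invariantField F ((Representation.leftRegular ℤ G).prod X.flowRep)

end GGraph

/-!
The class of `F(M)^G` up to stable isomorphism does not change when the faithful lattice `M` is
replaced by an extension `E` of a permutation lattice by `M`: a basis of `E / M` permuted by `G`
lifts to monomials which generate `F(E)` over `F(M)`, are algebraically independent, and whose
`F(M)`-span is stable under the semilinear action of `G`. By Galois descent this span has a basis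
of invariants, and these generate `F(E)^G` over `F(M)^G` (`exists_invariantField_algEquiv`).

It therefore suffices to join the two flow lattices by extensions of this kind. Let `A = G ⧸ ⟨τ⟩`
and `B = G ⧸ ⟨σ⟩`. Their cardinalities are the coprime orders of `σ` and `τ`, so that
`a |A| + b |B| = 1` for some integers `a` and `b`, while the fibres of `G → A` and `G → B` have
`|B|` and `|A|` elements. Let `X₃` be the graph on `B` with one edge from each coset to its
translate by `τ`; it is an oriented cycle, and its flow lattice is `ℤ` with trivial action.
The Bezout relation turns edge functions `p` on `X₂` and `q` on `X₃` and a function `x` on `G` into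
the function `x - b u∘α - a v∘β` of sum zero on `G`, where `u = α_* x - ∂p`, `v = β_* x - ∂q` and
`α`, `β` are the projections of `G` to `A`, `B`. The lattice of all `(f, p, q, x, z)` with `z ∈ ℤ`
for which this function is the boundary of the edge function `f` on `X₁` is an extension

* of the permutation lattice of all `(p, q, x, z)` by `Fl(X₁)`, since every function of sum zero is
  a boundary on a connected graph;
* of the permutation lattice of all `(f, u', v')` by `Fl(X₂) ⊕ Fl(X₃)`, where `u' = u + a z` and
  `v' = v - b z`. The free parameter `z` is what makes `(u', v')` range over all of `ℤ^A ⊕ ℤ^B`: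
  by themselves `u` and `v` have equal sums.

These are `exists_coverRep_algEquiv_flow` and `exists_coverRep_algEquiv_flow_prod`. As
`Fl(X₃) = ℤ`, the lattice `Fl(X₂) ⊕ Fl(X₃)` is itself an extension of a permutation lattice by
`Fl(X₂)`. The summand `ℤG` makes all these lattices faithful.
-/

/-! ### Invariants of a field generated by a stable linear span -/

section Descent

variable {F L L' G : Type*} [Field F] [Field L] [Field L'] [Algebra F L] [Algebra F L']
  [Algebra L L'] [Group G] [Finite G]
  (φ : G →* (L ≃ₐ[F] L)) (φ' : G →* (L' ≃ₐ[F] L'))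

/-- Galois descent: a subspace stable under the semilinear action of `G` is spanned by its
invariant vectors. A functional vanishing on the traces `∑ g, g (l v)` for all `l` vanishes on `v`
by the linear independence of the automorphisms `φ g`. -/
theorem le_span_fixed (hφ : Function.Injective φ)
    (hcomp : ∀ g l, φ' g (algebraMap L L' l) = algebraMap L L' (φ g l))
    (V : Submodule L L') (hV : ∀ g, ∀ v ∈ V, φ' g v ∈ V) :
    V ≤ Submodule.span L {v | v ∈ V ∧ ∀ g, φ' g v = v} := by
  classical
  have := Fintype.ofFinite G
  intro v hv
  by_contra hvn
  obtain ⟨f, hfv, hf⟩ := Submodule.exists_le_ker_of_notMem hvn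
  have hli : LinearIndependent L (fun g : G => (φ g : L → L)) :=
    (linearIndependent_monoidHom L L).comp
      (fun g => ((φ g : L →ₐ[F] L) : L →* L)) (by
        intro g h hgh
        apply hφ
        ext l
        exact DFunLike.congr_fun hgh l)
  rw [Fintype.linearIndependent_iff] at hli
  have h0 := hli (fun g => f (φ' g v)) (by
    funext l
    have hmem : ∑ g, φ' g (l • v) ∈ Submodule.span L {v | v ∈ V ∧ ∀ g, φ' g v = v} := by
      refine Submodule.subset_span ⟨V.sum_mem fun g _ => hV g _ (V.smul_mem _ hv), fun h => ?_⟩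
      rw [map_sum]
      simp only [← AlgEquiv.mul_apply, ← map_mul]
      exact Fintype.sum_equiv (Equiv.mulLeft h) _ _ fun _ => rfl
    have := hf hmem
    simp only [LinearMap.mem_ker, map_sum] at this
    rw [Finset.sum_apply, Pi.zero_apply, ← this]
    refine Finset.sum_congr rfl fun g _ => ?_
    have hg : φ' g (l • v) = φ g l • φ' g v := by
      rw [Algebra.smul_def, map_mul, hcomp, ← Algebra.smul_def]
    rw [hg, map_smul, Pi.smul_apply, smul_eq_mul, smul_eq_mul, mul_comm]) 1
  exact hfv (by simpa using h0)

/-- Algebraic independence is preserved by an invertible linear change of variables. -/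
theorem AlgebraicIndependent.of_span_eq {S : Type*} [Finite S] {x y : S → L'}
    (hx : AlgebraicIndependent L x) (hy : LinearIndependent L y)
    (hxy : Submodule.span L (Set.range x) = Submodule.span L (Set.range y)) :
    AlgebraicIndependent L y := by
  classical
  have := Fintype.ofFinite S
  have hA : ∀ i, ∃ c : S → L, ∑ s, c s • x s = y i := fun i =>
    (Submodule.mem_span_range_iff_exists_fun L).1 (hxy ▸ Submodule.subset_span ⟨i, rfl⟩)
  have hB : ∀ i, ∃ c : S → L, ∑ s, c s • y s = x i := fun i =>
    (Submodule.mem_span_range_iff_exists_fun L).1 (hxy ▸ Submodule.subset_span ⟨i, rfl⟩)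
  choose A hA using hA
  choose B hB using hB
  let P : MvPolynomial S L →ₐ[L] MvPolynomial S L :=
    MvPolynomial.aeval fun i => ∑ s, A i s • MvPolynomial.X s
  let Q : MvPolynomial S L →ₐ[L] MvPolynomial S L :=
    MvPolynomial.aeval fun i => ∑ s, B i s • MvPolynomial.X s
  have hAB : ∀ i j, ∑ s, A i s * B s j = if j = i then 1 else 0 := by
    intro i j
    have h1 : ∑ j, (∑ s, A i s * B s j) • y j = ∑ j, (if j = i then (1 : L) else 0) • y j := by
      simp only [ite_smul, one_smul, zero_smul, Finset.sum_ite_eq', Finset.mem_univ, if_true]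
      conv_rhs => rw [← hA i]
      simp_rw [← hB, Finset.smul_sum, Finset.sum_smul, mul_smul]
      exact Finset.sum_comm
    have h2 := Fintype.linearIndependent_iff.1 hy
      (fun j => (∑ s, A i s * B s j) - if j = i then 1 else 0)
      (by simp only [sub_smul, Finset.sum_sub_distrib, h1, sub_self]) j
    exact sub_eq_zero.1 h2
  have hQP : ∀ p, Q (P p) = p := by
    intro p
    have : Q.comp P = AlgHom.id L _ := by
      ext1 i
      simp only [P, Q, AlgHom.comp_apply, MvPolynomial.aeval_X, map_sum, map_smul,
        AlgHom.id_apply, Finset.smul_sum, smul_smul]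
      rw [Finset.sum_comm]
      simp only [← Finset.sum_smul, hAB, ite_smul, one_smul, zero_smul, Finset.sum_ite_eq',
        Finset.mem_univ, if_true]
    exact DFunLike.congr_fun this p
  have hcomp : (MvPolynomial.aeval y : MvPolynomial S L →ₐ[L] L') =
      (MvPolynomial.aeval x).comp P := by
    ext1 i
    simp [P, hA]
  rw [AlgebraicIndependent, hcomp]
  exact Function.Injective.comp (g := MvPolynomial.aeval x) hx
    (Function.LeftInverse.injective hQP)

/-- If algebraically independent generators of `L'` over `L` span a `G`-stable `L`-subspace, they
can be replaced by a basis of this subspace consisting of invariants. -/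
theorem exists_fixed_generators (hφ : Function.Injective φ)
    (hcomp : ∀ g l, φ' g (algebraMap L L' l) = algebraMap L L' (φ g l))
    {S : Type*} [Finite S] {x : S → L'} (hx : AlgebraicIndependent L x)
    (htop : IntermediateField.adjoin L (Set.range x) = ⊤)
    (hstable : ∀ g s, φ' g (x s) ∈ Submodule.span L (Set.range x)) :
    ∃ y : S → L', (∀ i g, φ' g (y i) = y i) ∧ AlgebraicIndependent L y ∧
      IntermediateField.adjoin L (Set.range y) = ⊤ := by
  set V := Submodule.span L (Set.range x) with hVdef
  have hV : ∀ g, ∀ v ∈ V, φ' g v ∈ V := by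
    intro g v hv
    induction hv using Submodule.span_induction with
    | mem v hv => obtain ⟨s, rfl⟩ := hv; exact hstable g s
    | zero => simp
    | add v w _ _ hv hw => rw [map_add]; exact V.add_mem hv hw
    | smul l v _ hv =>
      rw [Algebra.smul_def, map_mul, hcomp, ← Algebra.smul_def]
      exact V.smul_mem _ hv
  have hspan := le_span_fixed φ φ' hφ hcomp V hV
  obtain ⟨b, hbW, hbspan, hbli⟩ := exists_linearIndependent L {v | v ∈ V ∧ ∀ g, φ' g v = v}
  have hbV : Submodule.span L (Set.range ((↑) : b → L')) = V := by
    rw [Subtype.range_coe, hbspan]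
    exact le_antisymm (Submodule.span_le.2 fun v hv => hv.1) hspan
  let e : S ≃ b := (Module.Basis.span hx.linearIndependent).indexEquiv
    ((Module.Basis.span hbli).map (LinearEquiv.ofEq _ _ hbV))
  have hrange : Set.range (fun s => (e s : L')) = Set.range ((↑) : b → L') :=
    e.surjective.range_comp ((↑) : b → L')
  refine ⟨fun s => e s, fun i g => (hbW (e i).2).2 g,
    hx.of_span_eq (hbli.comp e e.injective) ?_, ?_⟩
  · change V = Submodule.span L (Set.range (fun s => (e s : L')))
    rw [hrange, hbV]
  · rw [eq_top_iff, ← htop, IntermediateField.adjoin_le_iff]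
    have : V ≤ (IntermediateField.adjoin L
        (Set.range fun s => (e s : L'))).toSubalgebra.toSubmodule := by
      rw [← hbV, ← hrange, Submodule.span_le]
      exact IntermediateField.subset_adjoin L _
    exact fun v hv => this (Submodule.subset_span hv)

/-- If `L'` is generated over `L` by invariant elements `y`, then its fixed field is generated by
`y` over the fixed field of `L`: every element of `L'` is a combination of elements of `L` with
coefficients in `L^G(y)`, so its trace lies in `L^G(y)`. -/
theorem fixedField_eq_adjoin [CharZero F] [IsScalarTower F L L']
    (hcomp : ∀ g l, φ' g (algebraMap L L' l) = algebraMap L L' (φ g l))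
    {S : Type*} {y : S → L'} (hy : ∀ i g, φ' g (y i) = y i)
    (htop : IntermediateField.adjoin L (Set.range y) = ⊤) :
    IntermediateField.fixedField φ'.range =
      (IntermediateField.adjoin (IntermediateField.fixedField φ.range)
        (Set.range y)).restrictScalars F := by
  classical
  have := Fintype.ofFinite G
  set K := IntermediateField.fixedField φ.range with hK
  set K' := IntermediateField.adjoin K (Set.range y) with hK'
  have hmemK : ∀ l : L, (∀ g, φ g l = l) → l ∈ K := by
    rintro l hl ⟨_, g, rfl⟩
    exact hl g
  have hfix : ∀ c ∈ K', ∀ g, φ' g c = c := by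
    intro c hc g
    induction hc using IntermediateField.adjoin_induction with
    | mem c hc => obtain ⟨i, rfl⟩ := hc; exact hy i g
    | algebraMap k =>
      rw [IsScalarTower.algebraMap_apply K L L', hcomp]
      exact congrArg _ (k.2 ⟨φ g, g, rfl⟩)
    | add a b _ _ ha hb => rw [map_add, ha, hb]
    | inv a _ ha => rw [map_inv₀, ha]
    | mul a b _ _ ha hb => rw [map_mul, ha, hb]
  have htrace : ∀ l : L, ∑ g, φ' g (algebraMap L L' l) ∈ K' := by
    intro l
    simp only [hcomp, ← map_sum]
    have : ∑ g, φ g l ∈ K := hmemK _ fun h => by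
      rw [map_sum]
      simp only [← AlgEquiv.mul_apply, ← map_mul]
      exact Fintype.sum_equiv (Equiv.mulLeft h) _ _ fun _ => rfl
    exact K'.algebraMap_mem ⟨_, this⟩
  have halg : ∀ l : L, IsAlgebraic K' (algebraMap L L' l) := by
    intro l
    have h1 : IsAlgebraic K l := (FixedPoints.isIntegral (G := φ.range) (F := L) l).isAlgebraic
    exact ((isAlgebraic_algebraMap_iff (algebraMap L L').injective).2 h1).tower_top K'
  have hspan : ∀ z : L', z ∈ Submodule.span K' (Set.range (algebraMap L L')) := by
    have hadj : (Algebra.adjoin K' (Set.range (algebraMap L L'))) = ⊤ := by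
      rw [← IntermediateField.adjoin_toSubalgebra_of_isAlgebraic
        (by rintro _ ⟨l, rfl⟩; exact halg l), ← IntermediateField.top_toSubalgebra]
      congr 1
      set K'' := IntermediateField.adjoin K' (Set.range (algebraMap L L'))
      rw [eq_top_iff]
      intro z _
      have hz : z ∈ IntermediateField.adjoin L (Set.range y) := htop ▸ IntermediateField.mem_top
      induction hz using IntermediateField.adjoin_induction with
      | mem c hc => exact K''.algebraMap_mem ⟨c, IntermediateField.subset_adjoin K _ hc⟩
      | algebraMap l => exact IntermediateField.subset_adjoin _ _ ⟨l, rfl⟩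
      | add a b _ _ ha hb => exact add_mem (ha trivial) (hb trivial)
      | inv a _ ha => exact inv_mem (ha trivial)
      | mul a b _ _ ha hb => exact mul_mem (ha trivial) (hb trivial)
    intro z
    have hz : z ∈ Subalgebra.toSubmodule (Algebra.adjoin K' (Set.range (algebraMap L L'))) := by
      rw [hadj]; trivial
    rw [Algebra.adjoin_eq_span] at hz
    rwa [show ((Submonoid.closure (Set.range (algebraMap L L')) : Submonoid L') : Set L') =
      Set.range (algebraMap L L') from congrArg _
        (Submonoid.closure_eq (MonoidHom.mrange (algebraMap L L' : L →* L')))] at hz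
  ext z
  rw [IntermediateField.mem_restrictScalars]
  refine ⟨fun hz => ?_, fun hz => ?_⟩
  · have htr : ∑ g, φ' g z ∈ K' := by
      clear hz
      induction hspan z using Submodule.span_induction with
      | mem v hv => obtain ⟨l, rfl⟩ := hv; exact htrace l
      | zero => simp
      | add v w _ _ hv hw =>
        simp only [map_add, Finset.sum_add_distrib]
        exact add_mem hv hw
      | smul c v _ hv =>
        simp only [Algebra.smul_def, map_mul]
        have : ∀ g, φ' g (algebraMap K' L' c) = algebraMap K' L' c := hfix c c.2
        simp only [this, ← Finset.mul_sum]
        exact mul_mem c.2 hv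
    have hsum : ∑ g, φ' g z = Fintype.card G • z := by
      have hz' : ∀ g, φ' g z = z := fun g => hz ⟨φ' g, g, rfl⟩
      simp [hz']
    rw [hsum, nsmul_eq_mul] at htr
    have := charZero_of_injective_algebraMap (algebraMap F L').injective
    have hcard : (Fintype.card G : L') ≠ 0 := Nat.cast_ne_zero.2 Fintype.card_ne_zero
    rw [← inv_mul_cancel_left₀ hcard z]
    exact mul_mem (inv_mem (natCast_mem _ _)) htr
  · rintro ⟨_, g, rfl⟩
    exact hfix z hz g

theorem exists_fixedField_algEquiv [CharZero F] [IsScalarTower F L L']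
    (hφ : Function.Injective φ)
    (hcomp : ∀ g l, φ' g (algebraMap L L' l) = algebraMap L L' (φ g l))
    {S : Type*} [Finite S] {x : S → L'} (hx : AlgebraicIndependent L x)
    (htop : IntermediateField.adjoin L (Set.range x) = ⊤)
    (hstable : ∀ g s, φ' g (x s) ∈ Submodule.span L (Set.range x)) :
    ∃ k : ℕ, Nonempty (IntermediateField.fixedField φ'.range ≃ₐ[F]
      FractionRing (MvPolynomial (Fin k) (IntermediateField.fixedField φ.range))) := by
  let e := Finite.equivFin S
  obtain ⟨y, hyfix, hy, hytop⟩ := exists_fixed_generators φ φ' hφ hcomp (x := x ∘ e.symm)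
    (hx.comp _ e.symm.injective) (by rwa [e.symm.surjective.range_comp])
    (fun g s => by rw [e.symm.surjective.range_comp]; exact hstable g _)
  refine ⟨Nat.card S, ⟨?_⟩⟩
  have hyK : AlgebraicIndependent (IntermediateField.fixedField φ.range) y :=
    hy.restrictScalars (K := L)
      (algebraMap (IntermediateField.fixedField φ.range) L).injective
  exact (IntermediateField.equivOfEq (fixedField_eq_adjoin φ φ' hcomp hyfix hytop)).trans
    (hyK.aevalEquivField.restrictScalars F).symm

end Descent

/-! ### Iterated rational function fields -/

section Iterated

theorem nonempty_fractionRing_algEquiv {F A K : Type*} [Field F] [CommRing A] [IsDomain A]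
    [Field K] [Algebra F A] [Algebra F K] (f : A →ₐ[F] K) (hf : Function.Injective f)
    (hdiv : ∀ z, ∃ x y, z = f x / f y) : Nonempty (FractionRing A ≃ₐ[F] K) := by
  let := f.toRingHom.toAlgebra
  have : FaithfulSMul A K := (faithfulSMul_iff_algebraMap_injective _ _).2 hf
  have : IsScalarTower F A K := IsScalarTower.of_algebraMap_eq' f.comp_algebraMap.symm
  have : IsFractionRing A K := IsFractionRing.of_field _ _ hdiv
  exact ⟨IsFractionRing.algEquivOfAlgEquiv (AlgEquiv.refl : A ≃ₐ[F] A)⟩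

/-- Rational functions in `m` variables over the rational functions in `k` variables are rational
functions in `m + k` variables. -/
theorem nonempty_iterated_algEquiv (F L : Type*) [Field F] [Field L] [Algebra F L] (m k : ℕ) :
    Nonempty (FractionRing (MvPolynomial (Fin m) (FractionRing (MvPolynomial (Fin k) L))) ≃ₐ[F]
      FractionRing (MvPolynomial (Fin (m + k)) L)) := by
  let R := MvPolynomial (Fin k) L
  let A := MvPolynomial (Fin m) R
  let B := MvPolynomial (Fin m) (FractionRing R)
  let ι : A →ₐ[F] B := MvPolynomial.mapAlgHom (IsScalarTower.toAlgHom F R (FractionRing R))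
  let f : A →ₐ[F] FractionRing B := (IsScalarTower.toAlgHom F B (FractionRing B)).comp ι
  have hι : Function.Injective ι :=
    MvPolynomial.map_injective _ (IsFractionRing.injective R (FractionRing R))
  have hf : Function.Injective f := (IsFractionRing.injective B (FractionRing B)).comp hι
  -- clear the denominators of the coefficients of `b`
  have hdiv : ∀ b : B, ∃ x y : A, y ≠ 0 ∧ b * ι y = ι x := by
    intro b
    let : Algebra A B := MvPolynomial.algebraMvPolynomial
    obtain ⟨⟨x, y, r, hr, hry⟩, h⟩ := IsLocalization.surj
      ((nonZeroDivisors R).map (MvPolynomial.C (σ := Fin m))) b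
    refine ⟨x, y, ?_, h⟩
    rintro rfl
    exact nonZeroDivisors.ne_zero hr (MvPolynomial.C_injective (Fin m) R (by simpa using hry))
  have hfrac : ∀ z, ∃ x y, z = f x / f y := by
    intro z
    obtain ⟨b, c, hc, rfl⟩ := IsFractionRing.div_surjective (A := B) z
    obtain ⟨x, y, hy, hxy⟩ := hdiv b
    obtain ⟨x', y', hy', hxy'⟩ := hdiv c
    have hc0 : algebraMap B (FractionRing B) c ≠ 0 :=
      IsFractionRing.to_map_ne_zero_of_mem_nonZeroDivisors hc
    have hy0 : f y ≠ 0 := (map_ne_zero_iff f hf).2 hy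
    have hy0' : f y' ≠ 0 := (map_ne_zero_iff f hf).2 hy'
    have h1 : algebraMap B (FractionRing B) b * f y = f x := by
      change _ * algebraMap B _ (ι y) = algebraMap B _ (ι x)
      rw [← map_mul, hxy]
    have h2 : algebraMap B (FractionRing B) c * f y' = f x' := by
      change _ * algebraMap B _ (ι y') = algebraMap B _ (ι x')
      rw [← map_mul, hxy']
    refine ⟨x * y', x' * y, ?_⟩
    rw [map_mul, map_mul, ← h1, ← h2]
    rw [div_eq_div_iff hc0 (mul_ne_zero (mul_ne_zero hc0 hy0') hy0)]
    ring
  let e : A ≃ₐ[F] MvPolynomial (Fin (m + k)) L :=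
    ((MvPolynomial.sumAlgEquiv L (Fin m) (Fin k)).symm.trans
      (MvPolynomial.renameEquiv L finSumFinEquiv)).restrictScalars F
  obtain ⟨e'⟩ := nonempty_fractionRing_algEquiv f hf hfrac
  exact ⟨e'.symm.trans (IsFractionRing.algEquivOfAlgEquiv e)⟩

theorem nonempty_fractionRing_mvPolynomial_algEquiv_congr {F L₁ L₂ : Type*} [Field F]
    [Field L₁] [Field L₂] [Algebra F L₁] [Algebra F L₂] (e : L₁ ≃ₐ[F] L₂) (k : ℕ) :
    Nonempty (FractionRing (MvPolynomial (Fin k) L₁) ≃ₐ[F]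
      FractionRing (MvPolynomial (Fin k) L₂)) :=
  ⟨IsFractionRing.algEquivOfAlgEquiv (MvPolynomial.mapAlgEquiv (Fin k) e)⟩

end Iterated

/-! ### Fields of lattices and extensions of permutation lattices -/

section LatticeFieldMap

variable (F : Type*) [Field F]

/-- The element `x^e` of the field `F(E)`. -/
noncomputable def latticeMonomial {E : Type*} [AddCommGroup E] (e : E) : LatticeField F E :=
  algebraMap (AddMonoidAlgebra F E) (LatticeField F E) (AddMonoidAlgebra.single e 1)

section Monomial

variable {E : Type*} [AddCommGroup E]

theorem latticeMonomial_zero : latticeMonomial F (0 : E) = 1 := by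
  rw [latticeMonomial, ← AddMonoidAlgebra.one_def, map_one]

theorem latticeMonomial_add (a b : E) :
    latticeMonomial F (a + b) = latticeMonomial F a * latticeMonomial F b := by
  rw [latticeMonomial, latticeMonomial, latticeMonomial, ← map_mul,
    AddMonoidAlgebra.single_mul_single, one_mul]

theorem latticeMonomial_injective :
    Function.Injective (latticeMonomial F : E → LatticeField F E) := by
  intro a b h
  have := IsFractionRing.injective (AddMonoidAlgebra F E) (LatticeField F E) h
  exact AddMonoidAlgebra.of_injective (R := F) (M := E) this

variable [Module ℤ E] [Module.Free ℤ E]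

theorem latticeMonomial_neg (e : E) : latticeMonomial F (-e) = (latticeMonomial F e)⁻¹ := by
  apply eq_inv_of_mul_eq_one_left
  rw [← latticeMonomial_add, neg_add_cancel, latticeMonomial_zero]

theorem latticeFieldAction_latticeMonomial {G : Type*} [Group G] (ρ : Representation ℤ G E) (g : G)
    (e : E) : latticeFieldAction F ρ g (latticeMonomial F e) = latticeMonomial F (ρ g e) := by
  simp only [latticeFieldAction, MonoidHom.comp_apply, latticeMonomial,
    IsFractionRing.fieldEquivOfAlgEquivHom_apply, IsFractionRing.fieldEquivOfAlgEquiv_algebraMap]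
  congr 1
  simp [groupAlgebraAction, latticeAddEquiv]

theorem latticeFieldAction_injective {G : Type*} [Group G] {ρ : Representation ℤ G E}
    (hρ : Function.Injective ρ) : Function.Injective (latticeFieldAction F ρ) := by
  intro g h hgh
  apply hρ
  ext e
  apply latticeMonomial_injective F
  rw [← latticeFieldAction_latticeMonomial, hgh, latticeFieldAction_latticeMonomial]

/-- The field `F(E)` is generated by the monomials. -/
theorem adjoin_latticeMonomial :
    IntermediateField.adjoin F (Set.range (latticeMonomial F : E → LatticeField F E)) = ⊤ := by
  rw [eq_top_iff]
  intro z _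
  set K := IntermediateField.adjoin F (Set.range (latticeMonomial F : E → LatticeField F E))
  have h : ∀ a : AddMonoidAlgebra F E, algebraMap _ (LatticeField F E) a ∈ K := by
    intro a
    induction a using AddMonoidAlgebra.induction_linear with
    | zero => rw [map_zero]; exact zero_mem K
    | add a b ha hb => rw [map_add]; exact add_mem ha hb
    | single e c =>
      have : AddMonoidAlgebra.single e c = c • AddMonoidAlgebra.single e (1 : F) := by simp
      rw [this, Algebra.smul_def, map_mul, ← IsScalarTower.algebraMap_apply, ← Algebra.smul_def]
      exact K.smul_mem (IntermediateField.subset_adjoin F _ ⟨e, rfl⟩)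
  obtain ⟨a, b, -, rfl⟩ := IsFractionRing.div_surjective (A := AddMonoidAlgebra F E) z
  exact div_mem (h a) (h b)

end Monomial

section Map

variable {M E : Type*} [AddCommGroup M] [Module ℤ M] [Module.Free ℤ M]
  [AddCommGroup E] [Module ℤ E] [Module.Free ℤ E] {ι : M →ₗ[ℤ] E} (hι : Function.Injective ι)

/-- The embedding `F(M) → F(E)` induced by an embedding of lattices `M → E`. -/
noncomputable def latticeFieldMap : LatticeField F M →ₐ[F] LatticeField F E :=
  IsFractionRing.liftAlgHom (g := (IsScalarTower.toAlgHom F (AddMonoidAlgebra F E)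
    (LatticeField F E)).comp (AddMonoidAlgebra.mapDomainAlgHom F F (ι : M →+ E)))
    (by
      rw [AlgHom.coe_comp]
      exact (IsFractionRing.injective (AddMonoidAlgebra F E) (LatticeField F E)).comp
        (AddMonoidAlgebra.mapDomain_injective hι))

theorem latticeFieldMap_algebraMap (a : AddMonoidAlgebra F M) :
    latticeFieldMap F hι (algebraMap _ _ a) =
      algebraMap (AddMonoidAlgebra F E) _
        (AddMonoidAlgebra.mapDomainAlgHom F F (ι : M →+ E) a) := by
  rw [latticeFieldMap, IsFractionRing.liftAlgHom_apply]
  exact IsFractionRing.lift_algebraMap _ a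

theorem latticeFieldMap_latticeMonomial (m : M) :
    latticeFieldMap F hι (latticeMonomial F m) = latticeMonomial F (ι m) := by
  rw [latticeMonomial, latticeFieldMap_algebraMap]
  simp [latticeMonomial]

theorem latticeFieldMap_action {G : Type*} [Group G] {ρM : Representation ℤ G M}
    {ρE : Representation ℤ G E} (hequiv : ∀ g m, ι (ρM g m) = ρE g (ι m)) (g : G)
    (l : LatticeField F M) :
    latticeFieldAction F ρE g (latticeFieldMap F hι l) =
      latticeFieldMap F hι (latticeFieldAction F ρM g l) := by
  have hl : l ∈ IntermediateField.adjoin F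
      (Set.range (latticeMonomial F : M → LatticeField F M)) := by
    rw [adjoin_latticeMonomial]; trivial
  induction hl using IntermediateField.adjoin_induction with
  | mem c hc =>
    obtain ⟨m, rfl⟩ := hc
    simp only [latticeFieldMap_latticeMonomial, latticeFieldAction_latticeMonomial, hequiv]
  | algebraMap k => simp
  | add a b _ _ ha hb => simp only [map_add, ha, hb]
  | inv a _ ha => simp only [map_inv₀, ha]
  | mul a b _ _ ha hb => simp only [map_mul, ha, hb]

/-- Monomials with exponents in distinct cosets of `M` are linearly independent over `F(M)`. -/
theorem eq_zero_of_sum_latticeFieldMap_mul {J : Type*} (e : J → E)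
    (he : ∀ i j m, e i - e j = ι m → i = j) (t : Finset J) (c : J → LatticeField F M)
    (h : ∑ j ∈ t, latticeFieldMap F hι (c j) * latticeMonomial F (e j) = 0) :
    ∀ j ∈ t, c j = 0 := by
  classical
  let := (latticeFieldMap F hι).toRingHom.toAlgebra
  let R := AddMonoidAlgebra F M
  let : Algebra R (LatticeField F E) :=
    ((latticeFieldMap F hι).toRingHom.comp (algebraMap R (LatticeField F M))).toAlgebra
  have : IsScalarTower R (LatticeField F M) (LatticeField F E) :=
    IsScalarTower.of_algebraMap_eq' rfl
  have hli : LinearIndependent R (fun j => latticeMonomial F (e j)) := by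
    rw [linearIndependent_iff']
    intro t a h k hk
    simp only [Algebra.smul_def] at h
    have h' : ∑ j ∈ t, AddMonoidAlgebra.mapDomainAlgHom F F (ι : M →+ E) (a j) *
        AddMonoidAlgebra.single (e j) 1 = 0 := by
      apply IsFractionRing.injective (AddMonoidAlgebra F E) (LatticeField F E)
      rw [map_zero, ← h, map_sum]
      refine Finset.sum_congr rfl fun j _ => ?_
      rw [map_mul, ← latticeFieldMap_algebraMap F hι]
      rfl
    ext m
    -- only the summand of `k` has exponents in the coset of `e k`
    have h2 := congrArg (fun f => f.coeff (ι m + e k)) h'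
    rw [AddMonoidAlgebra.coeff_sum, Finset.sum_apply', Finset.sum_eq_single k] at h2
    · simpa [Finsupp.mapDomain_apply hι] using h2
    · intro j _ hjk
      simp only [AddMonoidAlgebra.coeff_mul_single_apply, mul_one]
      exact Finsupp.mapDomain_of_notMem_range _ _ fun ⟨m', hm'⟩ =>
        hjk (he j k (m - m') (by
          change ι m' = _ at hm'
          rw [map_sub, hm']; abel))
    · exact fun h => absurd hk h
  have hli' := (LinearIndependent.iff_fractionRing R (LatticeField F M)).1 hli
  exact linearIndependent_iff'.1 hli' t c (by simp only [Algebra.smul_def]; exact h)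

end Map

/-- For an exact sequence `0 → M → E → ℤ^S → 0` of `G`-lattices with `M` faithful and `S` a finite
`G`-set, `F(E)^G` is purely transcendental of finite transcendence degree over `F(M)^G`. -/
theorem exists_invariantField_algEquiv [CharZero F] {G : Type*} [Group G] [Finite G]
    {M E S : Type*} [AddCommGroup M] [Module ℤ M] [Module.Free ℤ M]
    [AddCommGroup E] [Module ℤ E] [Module.Free ℤ E] [Finite S] [MulAction G S]
    {ρM : Representation ℤ G M} {ρE : Representation ℤ G E} (hρ : Function.Injective ρM)
    (ι : M →ₗ[ℤ] E) (hι : Function.Injective ι) (hιG : ∀ g m, ι (ρM g m) = ρE g (ι m))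
    (π : E →ₗ[ℤ] (S → ℤ)) (hπ : Function.Surjective π)
    (hπG : ∀ g e s, π (ρE g e) (g • s) = π e s) (hexact : ∀ e, π e = 0 → ∃ m, ι m = e)
    (hπι : ∀ m, π (ι m) = 0) :
    ∃ k : ℕ, Nonempty (invariantField F ρE ≃ₐ[F]
      FractionRing (MvPolynomial (Fin k) (invariantField F ρM))) := by
  classical
  have := Fintype.ofFinite S
  let := (latticeFieldMap F hι).toRingHom.toAlgebra
  have : IsScalarTower F (LatticeField F M) (LatticeField F E) :=
    IsScalarTower.of_algebraMap_eq' (latticeFieldMap F hι).comp_algebraMap.symm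
  -- the monomials of lifts `e s` of the basis of `ℤ^S`
  choose e he using fun s => hπ (Pi.single s 1)
  refine exists_fixedField_algEquiv (latticeFieldAction F ρM) (latticeFieldAction F ρE)
    (latticeFieldAction_injective F hρ) (latticeFieldMap_action F hι hιG)
    (x := fun s => latticeMonomial F (e s)) ?_ ?_ ?_
  · rw [algebraicIndependent_iff]
    intro p hp
    have hπsum : ∀ d : S →₀ ℕ, π (∑ s, d s • e s) = fun s => (d s : ℤ) := by
      intro d
      ext t
      simp [he, Finset.sum_apply, Pi.single_apply]
    have hmon : ∀ d : S →₀ ℕ,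
        ∏ s, latticeMonomial F (e s) ^ d s = latticeMonomial F (∑ s, d s • e s) := by
      have hpow : ∀ (n : ℕ) (a : E), latticeMonomial F a ^ n = latticeMonomial F (n • a) := by
        intro n a
        induction n with
        | zero => simp [latticeMonomial_zero]
        | succ n ih => rw [pow_succ, ih, succ_nsmul, latticeMonomial_add]
      have hprod : ∀ (t : Finset S) (a : S → E),
          ∏ s ∈ t, latticeMonomial F (a s) = latticeMonomial F (∑ s ∈ t, a s) := by
        intro t a
        induction t using Finset.induction_on with
        | empty => simp [latticeMonomial_zero]
        | insert s t hs ih => rw [Finset.prod_insert hs, Finset.sum_insert hs, ih,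
            latticeMonomial_add]
      intro d
      simp only [hpow, hprod]
    rw [MvPolynomial.aeval_def, MvPolynomial.eval₂_eq'] at hp
    simp only [hmon] at hp
    have := eq_zero_of_sum_latticeFieldMap_mul F hι (fun d : S →₀ ℕ => ∑ s, d s • e s)
      (by
        intro d d' m hm
        have := congrArg π hm
        rw [map_sub, hπsum, hπsum, hπι, sub_eq_zero] at this
        ext s
        exact_mod_cast congrFun this s) p.support (fun d => p.coeff d) hp
    ext d
    by_cases hd : d ∈ p.support
    · simpa using this d hd
    · simpa using hd
  · set K := IntermediateField.adjoin (LatticeField F M)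
      (Set.range fun s => latticeMonomial F (e s)) with hK
    -- the exponents whose monomials are generated; they contain `M` and the lifts `e s`
    let A : AddSubgroup E :=
      { carrier := {a | latticeMonomial F a ∈ K}
        zero_mem' := by
          change latticeMonomial F 0 ∈ K
          rw [latticeMonomial_zero]; exact one_mem K
        add_mem' := fun {a b} ha hb => by
          change latticeMonomial F (a + b) ∈ K
          rw [latticeMonomial_add]; exact mul_mem ha hb
        neg_mem' := fun {a} ha => by
          change latticeMonomial F (-a) ∈ K
          rw [latticeMonomial_neg]; exact inv_mem ha }
    have hιA : ∀ m, ι m ∈ A := fun m => by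
      change latticeMonomial F (ι m) ∈ K
      rw [← latticeFieldMap_latticeMonomial F hι]
      exact K.algebraMap_mem _
    have heA : ∀ s, e s ∈ A := fun s => IntermediateField.subset_adjoin _ _ ⟨s, rfl⟩
    have hA : ∀ a, a ∈ A := by
      intro a
      obtain ⟨m, hm⟩ := hexact (a - ∑ s, π a s • e s) (by
        ext t
        simp [he, Finset.sum_apply, Pi.single_apply])
      rw [eq_sub_iff_add_eq] at hm
      rw [← hm]
      exact A.add_mem (hιA m) (A.sum_mem fun s _ => A.zsmul_mem (heA s) _)
    rw [eq_top_iff]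
    intro z _
    have hz : z ∈ IntermediateField.adjoin F
        (Set.range (latticeMonomial F : E → LatticeField F E)) := by
      rw [adjoin_latticeMonomial]; trivial
    have hle : IntermediateField.adjoin F
        (Set.range (latticeMonomial F : E → LatticeField F E)) ≤ K.restrictScalars F := by
      rw [IntermediateField.adjoin_le_iff]
      rintro _ ⟨a, rfl⟩
      exact hA a
    exact hle hz
  · intro g s
    obtain ⟨m, hm⟩ := hexact (ρE g (e s) - e (g • s)) (by
      ext t
      obtain ⟨t, rfl⟩ := MulAction.surjective g t
      rw [map_sub, Pi.sub_apply, hπG, he, he]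
      simp [Pi.single_apply])
    rw [eq_sub_iff_add_eq] at hm
    rw [latticeFieldAction_latticeMonomial, ← hm, latticeMonomial_add,
      ← latticeFieldMap_latticeMonomial F hι]
    change algebraMap (LatticeField F M) _ _ * _ ∈ _
    rw [← Algebra.smul_def]
    exact Submodule.smul_mem _ _ (Submodule.subset_span ⟨g • s, rfl⟩)

end LatticeFieldMap

/-! ### Permutation lattices and boundaries -/

section Permutation

/-- The permutation lattice of functions `S → ℤ` on a `G`-set `S`, `(g f)(s) = f(g⁻¹ s)`. -/
def permRep (G S : Type*) [Group G] [MulAction G S] : Representation ℤ G (S → ℤ) where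
  toFun g := LinearMap.funLeft ℤ ℤ fun s => g⁻¹ • s
  map_one' := by
    ext f s
    simp
  map_mul' g h := by
    ext f s
    simp [mul_smul]

theorem permRep_apply {G S : Type*} [Group G] [MulAction G S] (g : G) (f : S → ℤ) (s : S) :
    permRep G S g f s = f (g⁻¹ • s) := rfl

open Classical in
/-- Push-forward of functions along a map `φ : S → T` of finite sets: sum over the fibres. -/
noncomputable def pushforward {S T : Type*} [Fintype S] (φ : S → T) : (S → ℤ) →ₗ[ℤ] (T → ℤ) where
  toFun f t := ∑ s, if φ s = t then f s else 0
  map_add' f g := by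
    ext t
    simp only [Pi.add_apply, ← Finset.sum_add_distrib]
    exact Finset.sum_congr rfl fun s _ => by split_ifs <;> simp
  map_smul' c f := by
    ext t
    simp [Finset.mul_sum]

variable {S T : Type*} [Fintype S] (φ : S → T)

theorem pushforward_apply [DecidableEq T] (f : S → ℤ) (t : T) :
    pushforward φ f t = ∑ s, if φ s = t then f s else 0 := by
  simp only [pushforward, LinearMap.coe_mk, AddHom.coe_mk]
  exact Finset.sum_congr rfl fun s _ => by congr

theorem sum_pushforward [Fintype T] (f : S → ℤ) : ∑ t, pushforward φ f t = ∑ s, f s := by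
  classical
  simp only [pushforward_apply]
  rw [Finset.sum_comm]
  simp

theorem pushforward_single [DecidableEq S] [DecidableEq T] (s : S) (c : ℤ) :
    pushforward φ (Pi.single s c) = Pi.single (φ s) c := by
  ext t
  rw [pushforward_apply, Finset.sum_eq_single s]
  · simp [Pi.single_apply, eq_comm]
  · intro s' _ hs
    simp [hs]
  · simp

theorem pushforward_permRep {G : Type*} [Group G] [MulAction G S] [MulAction G T]
    (hφ : ∀ (g : G) s, φ (g • s) = g • φ s) (g : G) (f : S → ℤ) :
    pushforward φ (permRep G S g f) = permRep G T g (pushforward φ f) := by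
  classical
  ext t
  simp only [permRep_apply, pushforward_apply]
  refine Fintype.sum_equiv (MulAction.toPerm g⁻¹) _ _ fun s => ?_
  simp only [MulAction.toPerm_apply, hφ, smul_left_cancel_iff]

end Permutation

namespace GGraph

variable {G V E : Type*} [Group G] [MulAction G V] [MulAction G E] [Fintype E] (X : GGraph G V E)

/-- The boundary of a function on the edges: at each vertex, outgoing minus incoming values. Its
kernel is the flow lattice. -/
noncomputable def boundary : (E → ℤ) →ₗ[ℤ] (V → ℤ) := pushforward X.source - pushforward X.target

theorem mem_flow_iff (f : E → ℤ) : f ∈ X.flow ↔ X.boundary f = 0 := by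
  classical
  rw [boundary, LinearMap.sub_apply, sub_eq_zero, funext_iff]
  simp only [pushforward_apply, ← Finset.sum_filter]
  refine forall_congr' fun v => ?_
  convert Iff.rfl

theorem boundary_permRep (g : G) (f : E → ℤ) :
    X.boundary (permRep G E g f) = permRep G V g (X.boundary f) := by
  rw [boundary, LinearMap.sub_apply, LinearMap.sub_apply, map_sub,
    pushforward_permRep _ X.source_smul, pushforward_permRep _ X.target_smul]

theorem sum_boundary [Fintype V] (f : E → ℤ) : ∑ v, X.boundary f v = 0 := by
  simp [boundary, sum_pushforward]

/-- For a connected graph every function on the vertices with sum zero is a boundary. -/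
theorem Connected.exists_boundary_eq {X : GGraph G V E} (hX : X.Connected) [Fintype V] {u : V → ℤ}
    (hu : ∑ v, u v = 0) : ∃ f, X.boundary f = u := by
  classical
  obtain ⟨v₀⟩ := hX.nonempty
  let R := LinearMap.range X.boundary
  have hedge : ∀ e, Pi.single (X.source e) (1 : ℤ) - Pi.single (X.target e) 1 ∈ R := fun e =>
    ⟨Pi.single e 1, by rw [boundary, LinearMap.sub_apply, pushforward_single, pushforward_single]⟩
  have hreach : ∀ v, Pi.single v (1 : ℤ) - Pi.single v₀ 1 ∈ R := by
    intro v
    have h := (SimpleGraph.reachable_iff_reflTransGen _ _).1 (hX.preconnected v₀ v)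
    induction h with
    | refl => simp
    | tail _ hbc ih =>
      rw [SimpleGraph.fromRel_adj] at hbc
      rcases hbc.2 with ⟨e, rfl, rfl⟩ | ⟨e, rfl, rfl⟩
      · simpa using R.sub_mem ih (hedge e)
      · simpa using R.add_mem (hedge e) ih
  have hsum : u = ∑ v, u v • (Pi.single v (1 : ℤ) - Pi.single v₀ 1) := by
    simp only [smul_sub, Finset.sum_sub_distrib, ← Finset.sum_smul, hu, zero_smul, sub_zero]
    ext t
    simp [Finset.sum_apply, Pi.single_apply]
  rw [hsum]
  exact R.sum_mem fun v _ => R.smul_mem _ (hreach v)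

theorem coe_flowRep (g : G) (f : X.flow) : (X.flowRep g f : E → ℤ) = permRep G E g f := rfl

end GGraph

/-! ### A lattice joining the flow lattices -/

section Cover

variable {G V A B E₁ E₂ E₃ : Type*} [Group G] [MulAction G V] [MulAction G A] [MulAction G B]
  [MulAction G E₁] [MulAction G E₂] [MulAction G E₃] [Fintype V]
  [Fintype E₁] [Fintype E₂] [Fintype E₃] (X₁ : GGraph G V E₁) (X₂ : GGraph G A E₂)
  (X₃ : GGraph G B E₃) (α : V → A) (β : V → B) (a b : ℤ)

/-- The lattice of tuples `(f, p, q, x, z)` of functions on the edges of three graphs, a function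
`x` on `V` and an integer `z`. -/
abbrev CoverAmbient (V E₁ E₂ E₃ : Type*) : Type _ :=
  (E₁ → ℤ) × (E₂ → ℤ) × (E₃ → ℤ) × (V → ℤ) × ℤ

/-- The map `(p, x) ↦ α_* x - ∂p`, which measures how far the push-forward of `x` to the vertices
of `X` is from being the boundary of `p`. -/
noncomputable def defectMap {V A E : Type*} [MulAction G A] [MulAction G E] [Fintype V]
    [Fintype E] (X : GGraph G A E) (α : V → A) : (E → ℤ) × (V → ℤ) →ₗ[ℤ] (A → ℤ) :=
  (pushforward α).comp (LinearMap.snd ℤ _ _) - X.boundary.comp (LinearMap.fst ℤ _ _)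

theorem defectMap_apply {V A E : Type*} [MulAction G A] [MulAction G E] [Fintype V]
    [Fintype E] (X : GGraph G A E) (α : V → A) (p : E → ℤ) (x : V → ℤ) :
    defectMap X α (p, x) = pushforward α x - X.boundary p := rfl

theorem defectMap_permRep {V A E : Type*} [MulAction G V] [MulAction G A] [MulAction G E]
    [Fintype V] [Fintype E] (X : GGraph G A E) {α : V → A}
    (hα : ∀ (g : G) v, α (g • v) = g • α v) (g : G) (p : E → ℤ) (x : V → ℤ) :
    defectMap X α (permRep G E g p, permRep G V g x) = permRep G A g (defectMap X α (p, x)) := by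
  rw [defectMap_apply, defectMap_apply, map_sub, pushforward_permRep _ hα, X.boundary_permRep]

/-- The lattice of all `(f, p, q, x, z)` with `∂f = x - b u∘α - a v∘β`, where `u = α_* x - ∂p` and
`v = β_* x - ∂q`. The integer `z` is unconstrained; it is needed for `coverModFlowProd` to be
surjective. -/
noncomputable def coverLattice : Submodule ℤ (CoverAmbient V E₁ E₂ E₃) where
  carrier := {w | X₁.boundary w.1 = w.2.2.2.1 -
    b • (defectMap X₂ α (w.2.1, w.2.2.2.1) ∘ α) - a • (defectMap X₃ β (w.2.2.1, w.2.2.2.1) ∘ β)}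
  zero_mem' := by
    change X₁.boundary 0 = 0 - b • (defectMap X₂ α 0 ∘ α) - a • (defectMap X₃ β 0 ∘ β)
    ext v
    simp
  add_mem' {w w'} hw hw' := by
    change X₁.boundary (w.1 + w'.1) = (w.2.2.2.1 + w'.2.2.2.1) -
      b • (defectMap X₂ α ((w.2.1, w.2.2.2.1) + (w'.2.1, w'.2.2.2.1)) ∘ α) -
      a • (defectMap X₃ β ((w.2.2.1, w.2.2.2.1) + (w'.2.2.1, w'.2.2.2.1)) ∘ β)
    rw [map_add, hw, hw', map_add, map_add]
    ext v
    simp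
    ring
  smul_mem' c w hw := by
    change X₁.boundary (c • w.1) = c • w.2.2.2.1 -
      b • (defectMap X₂ α (c • (w.2.1, w.2.2.2.1)) ∘ α) -
      a • (defectMap X₃ β (c • (w.2.2.1, w.2.2.2.1)) ∘ β)
    rw [map_smul, hw, map_smul, map_smul]
    ext v
    simp
    ring

/-- The action of `G` on `CoverAmbient` by permutations, trivial on the last component. -/
noncomputable def coverAmbientRep : Representation ℤ G (CoverAmbient V E₁ E₂ E₃) :=
  (permRep G E₁).prod ((permRep G E₂).prod ((permRep G E₃).prod
    ((permRep G V).prod (Representation.trivial ℤ G ℤ))))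

variable {α β}

/-- The action of `G` on `coverLattice`. -/
noncomputable def coverRep (hα : ∀ (g : G) v, α (g • v) = g • α v)
    (hβ : ∀ (g : G) v, β (g • v) = g • β v) :
    Representation ℤ G (coverLattice X₁ X₂ X₃ α β a b) where
  toFun g := (coverAmbientRep g).restrict (by
    rintro ⟨f, p, q, x, z⟩ hw
    change X₁.boundary f = x - b • (defectMap X₂ α (p, x) ∘ α) -
      a • (defectMap X₃ β (q, x) ∘ β) at hw
    change X₁.boundary (permRep G E₁ g f) = permRep G V g x -
      b • (defectMap X₂ α (permRep G E₂ g p, permRep G V g x) ∘ α) -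
      a • (defectMap X₃ β (permRep G E₃ g q, permRep G V g x) ∘ β)
    rw [X₁.boundary_permRep, defectMap_permRep _ hα, defectMap_permRep _ hβ, hw]
    ext v
    simp [permRep_apply, hα, hβ])
  map_one' := by
    ext1 w
    apply Subtype.ext
    change coverAmbientRep 1 w.1 = w.1
    rw [map_one]
    rfl
  map_mul' g h := by
    ext1 w
    apply Subtype.ext
    change coverAmbientRep (g * h) w.1 = coverAmbientRep g (coverAmbientRep h w.1)
    rw [map_mul]
    rfl

end Cover

/-! ### The two extensions -/

section Sequences

/-- The form of `exists_invariantField_algEquiv` in which faithfulness is provided by an additional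
summand `N`. -/
theorem exists_invariantField_prod_algEquiv (F : Type*) [Field F] [CharZero F] {G : Type*} [Group G]
    [Finite G] {N M E S : Type*} [AddCommGroup N] [Module.Free ℤ N]
    [AddCommGroup M] [Module.Free ℤ M]
    [AddCommGroup E] [Module.Free ℤ E] [Finite S] [MulAction G S]
    {ρN : Representation ℤ G N} (hρ : Function.Injective ρN)
    {ρM : Representation ℤ G M} {ρE : Representation ℤ G E}
    (ι : M →ₗ[ℤ] E) (hι : Function.Injective ι) (hιG : ∀ g m, ι (ρM g m) = ρE g (ι m))
    (π : E →ₗ[ℤ] (S → ℤ)) (hπ : Function.Surjective π)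
    (hπG : ∀ g e, π (ρE g e) = permRep G S g (π e)) (hexact : ∀ e, π e = 0 → ∃ m, ι m = e)
    (hπι : ∀ m, π (ι m) = 0) :
    ∃ k : ℕ, Nonempty (invariantField F (ρN.prod ρE) ≃ₐ[F]
      FractionRing (MvPolynomial (Fin k) (invariantField F (ρN.prod ρM)))) := by
  refine exists_invariantField_algEquiv (S := S) F ?_ (LinearMap.prodMap LinearMap.id ι) ?_ ?_
    (π.comp (LinearMap.snd ℤ N E)) ?_ ?_ ?_ ?_
  · intro g h hgh
    apply hρ
    ext n
    exact congrArg Prod.fst (DFunLike.congr_fun hgh (n, 0))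
  · rintro ⟨n, m⟩ ⟨n', m'⟩ h
    have h₁ : n = n' := congrArg Prod.fst h
    exact Prod.ext h₁ (hι (congrArg Prod.snd h))
  · rintro g ⟨n, m⟩
    exact Prod.ext rfl (hιG g m)
  · intro f
    obtain ⟨e, rfl⟩ := hπ f
    exact ⟨(0, e), rfl⟩
  · rintro g ⟨n, e⟩ s
    change π (ρE g e) (g • s) = π e s
    rw [hπG, permRep_apply, inv_smul_smul]
  · rintro ⟨n, e⟩ h
    obtain ⟨m, rfl⟩ := hexact e h
    exact ⟨(n, m), rfl⟩
  · rintro ⟨n, m⟩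
    exact hπι m

variable {G V A B E₁ E₂ E₃ : Type*} [Group G] [MulAction G V] [MulAction G A] [MulAction G B]
  [MulAction G E₁] [MulAction G E₂] [MulAction G E₃] [Fintype V]
  [Fintype E₁] [Fintype E₂] [Fintype E₃]
  {X₁ : GGraph G V E₁} {X₂ : GGraph G A E₂} {X₃ : GGraph G B E₃}
  {α : V → A} {β : V → B} {a b : ℤ}

theorem mem_coverLattice_iff {f : E₁ → ℤ} {p : E₂ → ℤ} {q : E₃ → ℤ} {x : V → ℤ} {z : ℤ} :
    (f, p, q, x, z) ∈ coverLattice X₁ X₂ X₃ α β a b ↔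
      X₁.boundary f = x - b • (defectMap X₂ α (p, x) ∘ α) - a • (defectMap X₃ β (q, x) ∘ β) :=
  Iff.rfl

theorem sum_defectMap {V A E : Type*} [MulAction G A] [MulAction G E] [Fintype V] [Fintype A]
    [Fintype E] (X : GGraph G A E) (α : V → A) (p : E → ℤ) (x : V → ℤ) :
    ∑ c, defectMap X α (p, x) c = ∑ v, x v := by
  simp [defectMap_apply, sum_pushforward, X.sum_boundary]

variable (X₁ X₂ X₃ α β a b)

/-- The map `(f, p, q, x, z) ↦ (p, q, x, z)`, with kernel `Fl(X₁)`. -/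
def coverModFlow : coverLattice X₁ X₂ X₃ α β a b →ₗ[ℤ] (E₂ ⊕ E₃ ⊕ V ⊕ Unit → ℤ) where
  toFun w := Sum.elim w.1.2.1 (Sum.elim w.1.2.2.1 (Sum.elim w.1.2.2.2.1 fun _ => w.1.2.2.2.2))
  map_add' w w' := by
    ext (s | s | s | s) <;> rfl
  map_smul' c w := by
    ext (s | s | s | s) <;> rfl

/-- The map `(f, p, q, x, z) ↦ (f, u + a z, v - b z)`, with kernel `Fl(X₂) ⊕ Fl(X₃)`. -/
noncomputable def coverModFlowProd : coverLattice X₁ X₂ X₃ α β a b →ₗ[ℤ] (E₁ ⊕ A ⊕ B → ℤ) where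
  toFun w := Sum.elim w.1.1 (Sum.elim
    (fun c => defectMap X₂ α (w.1.2.1, w.1.2.2.2.1) c + a * w.1.2.2.2.2)
    (fun c => defectMap X₃ β (w.1.2.2.1, w.1.2.2.2.1) c - b * w.1.2.2.2.2))
  map_add' w w' := by
    ext (s | s | s)
    · rfl
    · change defectMap X₂ α ((w.1.2.1, w.1.2.2.2.1) + (w'.1.2.1, w'.1.2.2.2.1)) s +
        a * (w.1.2.2.2.2 + w'.1.2.2.2.2) = _
      rw [map_add]
      simp only [Pi.add_apply, Sum.elim_inr, Sum.elim_inl]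
      ring
    · change defectMap X₃ β ((w.1.2.2.1, w.1.2.2.2.1) + (w'.1.2.2.1, w'.1.2.2.2.1)) s -
        b * (w.1.2.2.2.2 + w'.1.2.2.2.2) = _
      rw [map_add]
      simp only [Pi.add_apply, Sum.elim_inr]
      ring
  map_smul' c w := by
    ext (s | s | s)
    · rfl
    · change defectMap X₂ α (c • (w.1.2.1, w.1.2.2.2.1)) s + a * (c * w.1.2.2.2.2) = _
      rw [map_smul]
      simp only [Pi.smul_apply, Sum.elim_inr, Sum.elim_inl, RingHom.id_apply, smul_eq_mul]
      ring
    · change defectMap X₃ β (c • (w.1.2.2.1, w.1.2.2.2.1)) s - b * (c * w.1.2.2.2.2) = _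
      rw [map_smul]
      simp only [Pi.smul_apply, Sum.elim_inr, RingHom.id_apply, smul_eq_mul]
      ring

/-- The embedding `f ↦ (f, 0, 0, 0, 0)` of `Fl(X₁)`. -/
noncomputable def flowToCover : X₁.flow →ₗ[ℤ] coverLattice X₁ X₂ X₃ α β a b where
  toFun f := ⟨(f.1, 0, 0, 0, 0), by
    rw [mem_coverLattice_iff, (X₁.mem_flow_iff _).1 f.2]
    ext v
    simp [defectMap_apply]⟩
  map_add' f g := by
    apply Subtype.ext
    simp
  map_smul' c f := by
    apply Subtype.ext
    simp

/-- The embedding `(p, q) ↦ (0, p, q, 0, 0)` of `Fl(X₂) ⊕ Fl(X₃)`. -/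
noncomputable def flowProdToCover : X₂.flow × X₃.flow →ₗ[ℤ] coverLattice X₁ X₂ X₃ α β a b where
  toFun f := ⟨(0, f.1.1, f.2.1, 0, 0), by
    rw [mem_coverLattice_iff, defectMap_apply, defectMap_apply, (X₂.mem_flow_iff _).1 f.1.2,
      (X₃.mem_flow_iff _).1 f.2.2]
    ext v
    simp⟩
  map_add' f g := by
    apply Subtype.ext
    simp
  map_smul' c f := by
    apply Subtype.ext
    simp

variable {X₁ X₂ X₃ α β a b}

theorem coverModFlow_exact (w : coverLattice X₁ X₂ X₃ α β a b)
    (hw : coverModFlow X₁ X₂ X₃ α β a b w = 0) :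
    ∃ f, flowToCover X₁ X₂ X₃ α β a b f = w := by
  obtain ⟨⟨f, p, q, x, z⟩, hmem⟩ := w
  obtain rfl : p = 0 := funext fun e => congrFun hw (.inl e)
  obtain rfl : q = 0 := funext fun e => congrFun hw (.inr (.inl e))
  obtain rfl : x = 0 := funext fun e => congrFun hw (.inr (.inr (.inl e)))
  obtain rfl : z = 0 := congrFun hw (.inr (.inr (.inr ())))
  refine ⟨⟨f, (X₁.mem_flow_iff f).2 ?_⟩, rfl⟩
  rw [mem_coverLattice_iff] at hmem
  rw [hmem]
  ext v
  simp [defectMap_apply]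

variable [Fintype A] [Fintype B]

theorem coverModFlow_surjective (hX₁ : X₁.Connected)
    (hαcard : ∀ u : A → ℤ, ∑ v, u (α v) = Fintype.card B * ∑ c, u c)
    (hβcard : ∀ u : B → ℤ, ∑ v, u (β v) = Fintype.card A * ∑ c, u c)
    (hab : a * Fintype.card A + b * Fintype.card B = 1) :
    Function.Surjective (coverModFlow X₁ X₂ X₃ α β a b) := by
  intro h
  let p : E₂ → ℤ := fun e => h (.inl e)
  let q : E₃ → ℤ := fun e => h (.inr (.inl e))
  let x : V → ℤ := fun e => h (.inr (.inr (.inl e)))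
  obtain ⟨f, hf⟩ := hX₁.exists_boundary_eq
    (u := x - b • (defectMap X₂ α (p, x) ∘ α) - a • (defectMap X₃ β (q, x) ∘ β)) (by
      simp only [Pi.sub_apply, Pi.smul_apply, Function.comp_apply, Finset.sum_sub_distrib,
        smul_eq_mul, ← Finset.mul_sum, hαcard, hβcard, sum_defectMap]
      linear_combination (-∑ v, x v) * hab)
  refine ⟨⟨(f, p, q, x, h (.inr (.inr (.inr ())))), hf⟩, ?_⟩
  ext (s | s | s | s) <;> rfl

theorem coverModFlowProd_surjective (hX₂ : X₂.Connected) (hX₃ : X₃.Connected)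
    (hαcard : ∀ u : A → ℤ, ∑ v, u (α v) = Fintype.card B * ∑ c, u c)
    (hβcard : ∀ u : B → ℤ, ∑ v, u (β v) = Fintype.card A * ∑ c, u c)
    (hab : a * Fintype.card A + b * Fintype.card B = 1) :
    Function.Surjective (coverModFlowProd X₁ X₂ X₃ α β a b) := by
  intro h
  let f : E₁ → ℤ := fun e => h (.inl e)
  let u' : A → ℤ := fun e => h (.inr (.inl e))
  let v' : B → ℤ := fun e => h (.inr (.inr e))
  -- this `z` makes the sums of `u` and `v` agree, since `a |A| + b |B| = 1`
  let z : ℤ := ∑ c, u' c - ∑ c, v' c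
  let u : A → ℤ := fun c => u' c - a * z
  let v : B → ℤ := fun c => v' c + b * z
  have huv : ∑ c, u c = ∑ c, v c := by
    simp only [u, v, Finset.sum_sub_distrib, Finset.sum_add_distrib, Finset.sum_const,
      Finset.card_univ, nsmul_eq_mul]
    linear_combination (-z) * hab
  let x : V → ℤ := X₁.boundary f + b • (u ∘ α) + a • (v ∘ β)
  have hx : ∑ t, x t = ∑ c, u c := by
    simp only [x, Pi.add_apply, Pi.smul_apply, Function.comp_apply, Finset.sum_add_distrib,
      smul_eq_mul, ← Finset.mul_sum, hαcard, hβcard, X₁.sum_boundary, ← huv]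
    linear_combination (∑ c, u c) * hab
  obtain ⟨p, hp⟩ := hX₂.exists_boundary_eq (u := pushforward α x - u) (by
    simp [sum_pushforward, hx])
  obtain ⟨q, hq⟩ := hX₃.exists_boundary_eq (u := pushforward β x - v) (by
    simp [sum_pushforward, hx, huv])
  have hu : defectMap X₂ α (p, x) = u := by rw [defectMap_apply, hp, sub_sub_cancel]
  have hv : defectMap X₃ β (q, x) = v := by rw [defectMap_apply, hq, sub_sub_cancel]
  refine ⟨⟨(f, p, q, x, z), ?_⟩, ?_⟩
  · rw [mem_coverLattice_iff, hu, hv]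
    simp only [x]
    abel
  · ext (s | s | s)
    · rfl
    · change defectMap X₂ α (p, x) s + a * z = u' s
      rw [hu]
      simp [u]
    · change defectMap X₃ β (q, x) s - b * z = v' s
      rw [hv]
      simp [v]

theorem coverModFlowProd_exact (hab : a * Fintype.card A + b * Fintype.card B = 1)
    (w : coverLattice X₁ X₂ X₃ α β a b) (hw : coverModFlowProd X₁ X₂ X₃ α β a b w = 0) :
    ∃ f, flowProdToCover X₁ X₂ X₃ α β a b f = w := by
  obtain ⟨⟨f, p, q, x, z⟩, hmem⟩ := w
  obtain rfl : f = 0 := funext fun e => congrFun hw (.inl e)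
  have hu : ∀ c, defectMap X₂ α (p, x) c + a * z = 0 := fun c => congrFun hw (.inr (.inl c))
  have hv : ∀ c, defectMap X₃ β (q, x) c - b * z = 0 := fun c => congrFun hw (.inr (.inr c))
  have hu' := sum_defectMap X₂ α p x
  have hv' := sum_defectMap X₃ β q x
  simp only [eq_neg_of_add_eq_zero_left (hu _), Finset.sum_const, Finset.card_univ,
    nsmul_eq_mul] at hu'
  simp only [sub_eq_zero.1 (hv _), Finset.sum_const, Finset.card_univ, nsmul_eq_mul] at hv'
  -- the sums of `u = - a z` and `v = b z` both equal that of `x`, so `(a |A| + b |B|) z = 0`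
  obtain rfl : z = 0 := by linear_combination (-z) * hab + hv' - hu'
  have hu0 : defectMap X₂ α (p, x) = 0 := funext fun c => by simpa using hu c
  have hv0 : defectMap X₃ β (q, x) = 0 := funext fun c => by simpa using hv c
  rw [mem_coverLattice_iff, hu0, hv0, map_zero] at hmem
  obtain rfl : x = 0 := by
    rw [hmem]
    ext v
    simp
  rw [defectMap_apply, map_zero, zero_sub, neg_eq_zero] at hu0 hv0
  exact ⟨⟨⟨p, (X₂.mem_flow_iff p).2 hu0⟩, ⟨q, (X₃.mem_flow_iff q).2 hv0⟩⟩, rfl⟩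

theorem exists_coverRep_algEquiv_flow (F : Type*) [Field F] [CharZero F] [Finite G]
    {N : Type*} [AddCommGroup N] [Module.Free ℤ N]
    {ρN : Representation ℤ G N} (hρ : Function.Injective ρN)
    (hα : ∀ (g : G) v, α (g • v) = g • α v) (hβ : ∀ (g : G) v, β (g • v) = g • β v)
    (hX₁ : X₁.Connected)
    (hαcard : ∀ u : A → ℤ, ∑ v, u (α v) = Fintype.card B * ∑ c, u c)
    (hβcard : ∀ u : B → ℤ, ∑ v, u (β v) = Fintype.card A * ∑ c, u c)
    (hab : a * Fintype.card A + b * Fintype.card B = 1) :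
    ∃ k : ℕ, Nonempty (invariantField F (ρN.prod (coverRep X₁ X₂ X₃ a b hα hβ)) ≃ₐ[F]
      FractionRing (MvPolynomial (Fin k) (invariantField F (ρN.prod X₁.flowRep)))) := by
  refine exists_invariantField_prod_algEquiv F hρ (flowToCover X₁ X₂ X₃ α β a b) ?_ ?_
    (coverModFlow X₁ X₂ X₃ α β a b) (coverModFlow_surjective hX₁ hαcard hβcard hab) ?_
    coverModFlow_exact ?_
  · intro f g hfg
    exact Subtype.ext (congrArg (fun w => w.1.1) hfg)
  · intro g f
    apply Subtype.ext
    change _ = coverAmbientRep g (f.1, 0, 0, 0, 0)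
    simp [coverAmbientRep, flowToCover, X₁.coe_flowRep]
  · intro g w
    ext (s | s | s | s) <;> rfl
  · intro f
    ext (s | s | s | s) <;> rfl

theorem exists_coverRep_algEquiv_flow_prod (F : Type*) [Field F] [CharZero F] [Finite G]
    {N : Type*} [AddCommGroup N] [Module.Free ℤ N]
    {ρN : Representation ℤ G N} (hρ : Function.Injective ρN)
    (hα : ∀ (g : G) v, α (g • v) = g • α v) (hβ : ∀ (g : G) v, β (g • v) = g • β v)
    (hX₂ : X₂.Connected) (hX₃ : X₃.Connected)
    (hαcard : ∀ u : A → ℤ, ∑ v, u (α v) = Fintype.card B * ∑ c, u c)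
    (hβcard : ∀ u : B → ℤ, ∑ v, u (β v) = Fintype.card A * ∑ c, u c)
    (hab : a * Fintype.card A + b * Fintype.card B = 1) :
    ∃ k : ℕ, Nonempty (invariantField F (ρN.prod (coverRep X₁ X₂ X₃ a b hα hβ)) ≃ₐ[F]
      FractionRing (MvPolynomial (Fin k)
        (invariantField F (ρN.prod (X₂.flowRep.prod X₃.flowRep))))) := by
  refine exists_invariantField_prod_algEquiv F hρ (flowProdToCover X₁ X₂ X₃ α β a b) ?_ ?_
    (coverModFlowProd X₁ X₂ X₃ α β a b) (coverModFlowProd_surjective hX₂ hX₃ hαcard hβcard hab) ?_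
    (coverModFlowProd_exact hab) ?_
  · rintro ⟨f, f'⟩ ⟨g, g'⟩ hfg
    exact Prod.ext (Subtype.ext (congrArg (fun w => w.1.2.1) hfg))
      (Subtype.ext (congrArg (fun w => w.1.2.2.1) hfg))
  · rintro g ⟨f, f'⟩
    apply Subtype.ext
    change _ = coverAmbientRep g (0, f.1, f'.1, 0, 0)
    simp [coverAmbientRep, flowProdToCover, X₂.coe_flowRep, X₃.coe_flowRep]
  · rintro g ⟨⟨f, p, q, x, z⟩, hw⟩
    ext (s | s | s)
    · rfl
    · change defectMap X₂ α (permRep G E₂ g p, permRep G V g x) s + a * z = _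
      rw [defectMap_permRep _ hα]
      rfl
    · change defectMap X₃ β (permRep G E₃ g q, permRep G V g x) s - b * z = _
      rw [defectMap_permRep _ hβ]
      rfl
  · rintro ⟨f, f'⟩
    ext (s | s | s)
    · rfl
    · change defectMap X₂ α (f.1, 0) s + a * 0 = 0
      simp [defectMap_apply, (X₂.mem_flow_iff _).1 f.2]
    · change defectMap X₃ β (f'.1, 0) s - b * 0 = 0
      simp [defectMap_apply, (X₃.mem_flow_iff _).1 f'.2]

end Sequences

/-! ### The cycle on a cyclic quotient -/

section Cyclic

variable {G : Type*} [Group G]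

/-- The graph on the quotient group `G ⧸ N` with an edge `v → v τ` for each vertex `v`, the edge
being labelled by its source. -/
def quotientCycle (N : Subgroup G) [N.Normal] (τ : G) : GGraph G (G ⧸ N) (G ⧸ N) where
  source v := v
  target v := v * QuotientGroup.mk τ
  source_smul _ _ := rfl
  target_smul g v := by
    induction v using QuotientGroup.induction_on with
    | H x => exact congrArg QuotientGroup.mk (mul_assoc g x τ)

variable {N : Subgroup G} [N.Normal] {τ : G}

theorem quotientCycle_connected [Finite G]
    (hτ : ∀ v : G ⧸ N, v ∈ Subgroup.zpowers (QuotientGroup.mk τ : G ⧸ N)) :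
    (quotientCycle N τ).Connected := by
  have : ∀ v : G ⧸ N, (SimpleGraph.fromRel fun u v : G ⧸ N =>
      ∃ e, (quotientCycle N τ).source e = u ∧ (quotientCycle N τ).target e = v).Reachable 1 v := by
    intro v
    obtain ⟨k, rfl⟩ := mem_powers_iff_mem_zpowers.2 (hτ v)
    induction k with
    | zero => simp
    | succ k ih =>
      refine ih.trans ?_
      change SimpleGraph.Reachable _ _ ((QuotientGroup.mk τ : G ⧸ N) ^ (k + 1))
      by_cases h : (QuotientGroup.mk τ : G ⧸ N) ^ k = (QuotientGroup.mk τ : G ⧸ N) ^ (k + 1)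
      · rw [← h]
      · exact SimpleGraph.Adj.reachable ((SimpleGraph.fromRel_adj _ _ _).2
          ⟨h, Or.inl ⟨_, rfl, (pow_succ _ _).symm⟩⟩)
  have hne : Nonempty (G ⧸ N) := ⟨1⟩
  exact ⟨fun u v => (this u).symm.trans (this v)⟩

/-- If `τ` generates `G ⧸ N`, the flows on the cycle are the constant functions. -/
theorem mem_quotientCycle_flow_iff [Finite G] [Fintype (G ⧸ N)]
    (hτ : ∀ v : G ⧸ N, v ∈ Subgroup.zpowers (QuotientGroup.mk τ : G ⧸ N)) (f : G ⧸ N → ℤ) :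
    f ∈ (quotientCycle N τ).flow ↔ ∀ v, f v = f 1 := by
  classical
  have hb : ∀ v, (quotientCycle N τ).boundary f v = f v - f (v * (QuotientGroup.mk τ)⁻¹) := by
    intro v
    change pushforward (fun s => s) f v - pushforward (fun s => s * QuotientGroup.mk τ) f v = _
    simp [pushforward_apply, ← eq_mul_inv_iff_mul_eq]
  rw [GGraph.mem_flow_iff]
  refine ⟨fun h v => ?_, fun h => ?_⟩
  · obtain ⟨k, rfl⟩ := mem_powers_iff_mem_zpowers.2 (hτ v)
    induction k with
    | zero => simp
    | succ k ih =>
      rw [← ih]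
      have := congrFun h ((QuotientGroup.mk τ : G ⧸ N) ^ (k + 1))
      rw [hb, pow_succ, mul_inv_cancel_right] at this
      change f ((QuotientGroup.mk τ : G ⧸ N) ^ (k + 1)) = _
      rw [pow_succ]
      exact sub_eq_zero.1 this
  · ext v
    rw [hb, h v, h (v * _), sub_self, Pi.zero_apply]

theorem exists_flow_prod_quotientCycle_algEquiv (F : Type*) [Field F] [CharZero F] [Finite G]
    [Fintype (G ⧸ N)] (hτ : ∀ v : G ⧸ N, v ∈ Subgroup.zpowers (QuotientGroup.mk τ : G ⧸ N))
    {L M : Type*} [AddCommGroup L] [Module.Free ℤ L] [AddCommGroup M] [Module.Free ℤ M]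
    {ρL : Representation ℤ G L} (hρ : Function.Injective ρL) (ρM : Representation ℤ G M) :
    ∃ k : ℕ, Nonempty (invariantField F (ρL.prod (ρM.prod (quotientCycle N τ).flowRep)) ≃ₐ[F]
      FractionRing (MvPolynomial (Fin k) (invariantField F (ρL.prod ρM)))) := by
  have hconst : ∀ (q : (quotientCycle N τ).flow) v, q.1 v = q.1 1 := fun q =>
    (mem_quotientCycle_flow_iff hτ q.1).1 q.2
  let π : M × (quotientCycle N τ).flow →ₗ[ℤ] (Unit → ℤ) :=
    { toFun := fun w _ => w.2.1 1
      map_add' := fun _ _ => rfl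
      map_smul' := fun _ _ => rfl }
  refine exists_invariantField_prod_algEquiv (S := Unit) F hρ
    (LinearMap.inl ℤ M (quotientCycle N τ).flow) LinearMap.inl_injective ?_ π ?_ ?_ ?_ ?_
  · intro g m
    exact Prod.ext rfl (map_zero ((quotientCycle N τ).flowRep g)).symm
  · intro c
    exact ⟨(0, ⟨fun _ => c (), (mem_quotientCycle_flow_iff hτ _).2 fun _ => rfl⟩), rfl⟩
  · rintro g ⟨m, q⟩
    ext
    exact hconst q _
  · rintro ⟨m, q⟩ h
    refine ⟨m, Prod.ext rfl (Subtype.ext (funext fun v => ?_))⟩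
    rw [hconst q v]
    exact (congrFun h ()).symm
  · intro m
    rfl

end Cyclic

/-! ### Generators with coprime orders -/

section Group

variable {G : Type*} [Group G] {σ τ : G} {r : ℤ}

theorem mem_zpowers_quotient_mk (hgen : Subgroup.closure {σ, τ} = ⊤)
    [(Subgroup.zpowers σ).Normal] (v : G ⧸ Subgroup.zpowers σ) :
    v ∈ Subgroup.zpowers (QuotientGroup.mk τ : G ⧸ Subgroup.zpowers σ) := by
  induction v using QuotientGroup.induction_on with
  | H x =>
    have hle : Subgroup.closure {σ, τ} ≤
        (Subgroup.zpowers (QuotientGroup.mk τ : G ⧸ Subgroup.zpowers σ)).comap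
          (QuotientGroup.mk' _) := by
      rw [Subgroup.closure_le]
      rintro y (rfl | rfl)
      · change (QuotientGroup.mk y : G ⧸ Subgroup.zpowers y) ∈
          Subgroup.zpowers (QuotientGroup.mk τ : G ⧸ Subgroup.zpowers y)
        rw [(QuotientGroup.eq_one_iff y).2 (Subgroup.mem_zpowers y)]
        exact one_mem _
      · exact Subgroup.mem_zpowers _
    exact hle (hgen ▸ Subgroup.mem_top x)

variable [Finite G]

theorem zpowers_normal_of_conj (hgen : Subgroup.closure {σ, τ} = ⊤) (hrel : τ⁻¹ * σ * τ = σ ^ r) :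
    (Subgroup.zpowers σ).Normal := by
  have hτ : τ⁻¹ ∈ Subgroup.normalizer (Subgroup.zpowers σ : Set G) := by
    refine Subgroup.mem_normalizer_fintype ?_
    rintro _ ⟨k, rfl⟩
    refine ⟨r * k, ?_⟩
    change σ ^ (r * k) = τ⁻¹ * σ ^ k * τ⁻¹⁻¹
    rw [zpow_mul, ← hrel, ← conj_zpow, inv_inv]
  rw [← Subgroup.normalizer_eq_top_iff, eq_top_iff, ← hgen, Subgroup.closure_le]
  rintro x (rfl | rfl)
  · exact Subgroup.le_normalizer (Subgroup.mem_zpowers x)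
  · simpa using inv_mem hτ

theorem card_quotient_zpowers (hgen : Subgroup.closure {σ, τ} = ⊤)
    (hcoprime : Nat.Coprime (orderOf σ) (orderOf τ)) [(Subgroup.zpowers σ).Normal] :
    Nat.card (G ⧸ Subgroup.zpowers σ) = orderOf τ ∧
      Nat.card (G ⧸ Subgroup.zpowers τ) = orderOf σ := by
  have h₁ := Subgroup.card_eq_card_quotient_mul_card_subgroup (Subgroup.zpowers σ)
  have h₂ := Subgroup.card_eq_card_quotient_mul_card_subgroup (Subgroup.zpowers τ)
  rw [Nat.card_zpowers] at h₁ h₂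
  have hdvd : Nat.card (G ⧸ Subgroup.zpowers σ) ∣ orderOf τ := by
    rw [← orderOf_eq_card_of_forall_mem_zpowers (mem_zpowers_quotient_mk hgen)]
    exact orderOf_map_dvd (QuotientGroup.mk' (Subgroup.zpowers σ)) τ
  have hcard : Nat.card (G ⧸ Subgroup.zpowers σ) = orderOf τ :=
    Nat.dvd_antisymm hdvd (hcoprime.symm.dvd_of_dvd_mul_right (h₁ ▸ orderOf_dvd_natCard τ))
  refine ⟨hcard, Nat.eq_of_mul_eq_mul_right (orderOf_pos τ) ?_⟩
  rw [← h₂, h₁, hcard, mul_comm]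

/-- Each fibre of `G → G ⧸ H` has `|H|` elements. -/
theorem sum_comp_quotient_mk [Fintype G] (H : Subgroup G) [Fintype (G ⧸ H)] (u : G ⧸ H → ℤ) :
    ∑ g : G, u (QuotientGroup.mk g) = Nat.card H * ∑ c, u c := by
  classical
  have := Fintype.ofFinite H
  rw [← Fintype.sum_equiv (Subgroup.groupEquivQuotientProdSubgroup (s := H)).symm
    (fun c => u c.1) _ ?_]
  · simp [Fintype.sum_prod_type, Finset.mul_sum]
  · intro c
    obtain ⟨g, rfl⟩ := Subgroup.groupEquivQuotientProdSubgroup.surjective c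
    rw [Equiv.symm_apply_apply]
    rfl

end Group

theorem mainTheorem5 {F : Type*} [Field F] [CharZero F] {G : Type*} [Group G] [Finite G]
    (σ τ : G) (r : ℤ)
    (hgen : Subgroup.closure {σ, τ} = ⊤)
    (hcoprime : Nat.Coprime (orderOf σ) (orderOf τ))
    (hrel : τ⁻¹ * σ * τ = σ ^ r)
    {E₁ : Type*} [Fintype E₁] [MulAction G E₁]
    (X₁ : GGraph G G E₁) (hX₁ : X₁.Connected)
    {E₂ : Type*} [Fintype E₂] [MulAction G E₂]
    (X₂ : GGraph G (G ⧸ Subgroup.zpowers τ) E₂) (hX₂ : X₂.Connected) :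
    StablyIsomorphic F (X₁.flowInvariantField F) (X₂.flowInvariantField F) := by
  classical
  have := Fintype.ofFinite G
  have hN := zpowers_normal_of_conj hgen hrel
  have := Fintype.ofFinite (G ⧸ Subgroup.zpowers σ)
  have := Fintype.ofFinite (G ⧸ Subgroup.zpowers τ)
  obtain ⟨hcσ, hcτ⟩ := card_quotient_zpowers hgen hcoprime
  have hτ := mem_zpowers_quotient_mk (σ := σ) (τ := τ) hgen
  have hαcard : ∀ u : G ⧸ Subgroup.zpowers τ → ℤ, ∑ g : G, u (QuotientGroup.mk g) =
      Fintype.card (G ⧸ Subgroup.zpowers σ) * ∑ c, u c := fun u => by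
    rw [sum_comp_quotient_mk, ← Nat.card_eq_fintype_card, hcσ, Nat.card_zpowers]
  have hβcard : ∀ u : G ⧸ Subgroup.zpowers σ → ℤ, ∑ g : G, u (QuotientGroup.mk g) =
      Fintype.card (G ⧸ Subgroup.zpowers τ) * ∑ c, u c := fun u => by
    rw [sum_comp_quotient_mk, ← Nat.card_eq_fintype_card, hcτ, Nat.card_zpowers]
  obtain ⟨a, b, hab⟩ := Nat.isCoprime_iff_coprime.2 hcoprime
  rw [← hcτ, ← hcσ, Nat.card_eq_fintype_card, Nat.card_eq_fintype_card] at hab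
  have hρ : Function.Injective (Representation.leftRegular ℤ G) := by
    intro g h hgh
    have := DFunLike.congr_fun hgh (MonoidAlgebra.single 1 1)
    exact MonoidAlgebra.of_injective (R := ℤ) (by simpa using this)
  obtain ⟨k₁, ⟨e₁⟩⟩ := exists_coverRep_algEquiv_flow F (X₁ := X₁) (X₂ := X₂)
    (X₃ := quotientCycle (Subgroup.zpowers σ) τ) hρ (fun _ _ => rfl) (fun _ _ => rfl) hX₁
    hαcard hβcard hab
  obtain ⟨k₃, ⟨e₃⟩⟩ := exists_coverRep_algEquiv_flow_prod F (X₁ := X₁) (X₂ := X₂)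
    (X₃ := quotientCycle (Subgroup.zpowers σ) τ) hρ (fun _ _ => rfl) (fun _ _ => rfl) hX₂
    (quotientCycle_connected hτ) hαcard hβcard hab
  obtain ⟨k₂, ⟨e₂⟩⟩ := exists_flow_prod_quotientCycle_algEquiv F hτ hρ X₂.flowRep
  obtain ⟨e⟩ := nonempty_fractionRing_mvPolynomial_algEquiv_congr e₂ k₃
  obtain ⟨e'⟩ := nonempty_iterated_algEquiv F (X₂.flowInvariantField F) k₃ k₂
  exact ⟨k₁, k₃ + k₂, ⟨e₁.symm.trans (e₃.trans (e.trans e'))⟩⟩
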